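/- Let $d,n\ge 0$ and let $(M,\pi)$ be a regular Poisson manifold of rank $d$ and dimension $2d+n$: a Hausdorff, second countable smooth manifold with a smooth bivector field $\pi$ such that $[\pi,\pi]=0$ (i.e. the bracket $\{\psi,\phi\}=\pi(d\psi,d\phi)$ on $C^\infty(M)$ satisfies the Jacobi identity) and such that the map $T_x^*M\to T_xM$ defined by $\pi$ has rank $2d$ at every $x\in M$. Let ${\rm Pois}^1(M)$ be the set of $C^1$-diffeomorphisms $f\colon M\to M$ with $\pi_{f(x)}(\xi,\eta)=\pi_x(f^*\xi,f^*\eta)$ for all $x\in M$ and $\xi,\eta\in T^*_{f(x)}M$. A Darboux chart is a smooth chart $\varphi$ of $M$ with $\varphi_*\pi=\sum_{i=1}^d\frac{\partial}{\partial x_i}\wedge\frac{\partial}{\partial y_i}$, where $(x_1,\dots,x_d,y_1,\dots,y_d,z_1,\dots,z_n)$ are the coordinates of $\mathbb R^{2d}\times\mathbb R^n$. Let $f\in{\rm Pois}^1(M)$ and $p\in M$, and fix Darboux charts $\varphi$ around $p$ and $\psi$ around $f(p)$. For $g\in{\rm Pois}^1(M)$ with $g(p)=f(p)$ let $D_pg$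 denote the matrix of the derivative of $\psi\circ g\circ\varphi^{-1}$ at $\varphi(p)$. Let $\mathrm{Sp}(2d,\mathbb R)$ be the group of real matrices $A$ with $A^T\mathbb J A=\mathbb J$, $\mathbb J=\begin{pmatrix}0&-I\\ I&0\end{pmatrix}$, with the norm $\|[a_{ij}]\|=\max_j\sum_i|a_{ij}|$ on matrices, and for $A\in\mathrm{Sp}(2d,\mathbb R)$ put $A_\pi=\begin{pmatrix}A&0\\0&I\end{pmatrix}$, a square matrix of size $2d+n$. To measure $C^1$-distances from $f$, fix smooth charts $(U_i,\varphi_i)$ and $(W_i,\psi_i)$ of $M$ and compact sets $K_i\subset U_i$ with $f(K_i)\subset W_i$, such that the family $(K_i)_i$ is locally finite. Let $\|g-f\|_{C^1}$ be the supremum, over all $i$ and all $u\in\varphi_i(K_i)$, of the norms of the differences at $u$ of the maps $\psi_i\circ g\circ\varphi_i^{-1}$ and $\psi_i\circ f\circ\varphi_i^{-1}$ and of their derivatives, with $\|g-f\|_{C^1}=\infty$ if $g(K_i)\not\subset W_i$ for some $i$. For $\varepsilon>0$ and $D\subset M$ put $$B_\varepsilon(f,D)=\{g\in{\rm Pois}^1(M)\colon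 \|g-f\|_{C^1}<\varepsilon,\ g=f\text{ on }D\}.$$ Theorem. For every $\varepsilon>0$ there is $\delta>0$ such that for every neighborhood $V$ of $p$, $$\{A_\pi D_pf\colon A\in\mathrm{Sp}(2d,\mathbb R),\ \|A-I\|<\delta\}\subset\{D_pg\colon g\in B_\varepsilon(f,D)\},\qquad D=(M\setminus V)\cup\{p\}.$$ -/

import Mathlib

open Set Topology
open scoped Manifold ContDiff ENNReal

noncomputable section

/-- The space `ℝ^{2d} × ℝ^n`, with coordinates `(x₁,…,x_d, y₁,…,y_d, z₁,…,z_n)`. -/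
abbrev PSpace (d n : ℕ) : Type := EuclideanSpace ℝ ((Fin d ⊕ Fin d) ⊕ Fin n)

section Manifold

variable (E : Type*) [NormedAddCommGroup E] [NormedSpace ℝ E]

/-- The cotangent space of a manifold (modelled on `E`) at a point. -/
abbrev Cotangent {M : Type*} [TopologicalSpace M] [ChartedSpace E M] (x : M) : Type _ :=
  TangentSpace 𝓘(ℝ, E) x →L[ℝ] ℝ

/-- The differential `dψ` at `x` of a real function `ψ`. -/
def dAt {M : Type*} [TopologicalSpace M] [ChartedSpace E M] (ψ : M → ℝ) (x : M) :
    Cotangent E x :=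
  mfderiv 𝓘(ℝ, E) 𝓘(ℝ, ℝ) ψ x

/-- The bracket `{ψ, φ} = π(dψ, dφ)` associated to a field `π` of bilinear forms on the
cotangent spaces. -/
def bracketOf {M : Type*} [TopologicalSpace M] [ChartedSpace E M]
    (π : ∀ x : M, LinearMap.BilinForm ℝ (Cotangent E x)) (ψ φ : M → ℝ) : M → ℝ :=
  fun x => π x (dAt E ψ x) (dAt E φ x)

/-- A Poisson structure: a smooth bivector field `π` whose bracket `{ψ, φ} = π(dψ, dφ)`
on smooth functions satisfies the Jacobi identity (equivalently, `[π, π] = 0`). -/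
structure PoissonStructure (M : Type*) [TopologicalSpace M] [ChartedSpace E M] where
  /-- the bivector at each point, as a bilinear form on the cotangent space -/
  bivector : ∀ x : M, LinearMap.BilinForm ℝ (Cotangent E x)
  alternating : ∀ x, (bivector x).IsAlt
  smooth : ∀ ψ φ : M → ℝ, ContMDiff 𝓘(ℝ, E) 𝓘(ℝ, ℝ) ∞ ψ → ContMDiff 𝓘(ℝ, E) 𝓘(ℝ, ℝ) ∞ φ →
    ContMDiff 𝓘(ℝ, E) 𝓘(ℝ, ℝ) ∞ (bracketOf E bivector ψ φ)
  jacobi : ∀ ψ φ η : M → ℝ, ContMDiff 𝓘(ℝ, E) 𝓘(ℝ, ℝ) ∞ ψ → ContMDiff 𝓘(ℝ, E) 𝓘(ℝ, ℝ) ∞ φ →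
    ContMDiff 𝓘(ℝ, E) 𝓘(ℝ, ℝ) ∞ η → ∀ x,
      bracketOf E bivector ψ (bracketOf E bivector φ η) x
        + bracketOf E bivector φ (bracketOf E bivector η ψ) x
        + bracketOf E bivector η (bracketOf E bivector ψ φ) x = 0

variable {E} {M : Type*} [TopologicalSpace M] [ChartedSpace E M]

/-- The Poisson structure is regular of rank `d`: at every point the map
`ξ ↦ π(ξ, ·)` from the cotangent space to the tangent space (seen in its bidual) has a
`2d`-dimensional image, so that all symplectic leaves have dimension `2d`. -/
def PoissonStructure.IsRegularOfRank (π : PoissonStructure E M) (d : ℕ) : Prop :=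
  ∀ x : M, Module.finrank ℝ (LinearMap.range (π.bivector x)) = 2 * d

/-- The `C¹`-diffeomorphism `f` is Poisson: `f_* π = π`, that is,
`π_{f(x)}(ξ, η) = π_x(f^*ξ, f^*η)` for all covectors `ξ, η` at `f(x)`. -/
def IsPoissonDiffeo (π : PoissonStructure E M) (f : M ≃ₘ^1⟮𝓘(ℝ, E), 𝓘(ℝ, E)⟯ M) : Prop :=
  ∀ (x : M) (ξ η : Cotangent E (f x)),
    π.bivector (f x) ξ η =
      π.bivector x (ξ.comp (mfderiv 𝓘(ℝ, E) 𝓘(ℝ, E) f x))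
        (η.comp (mfderiv 𝓘(ℝ, E) 𝓘(ℝ, E) f x))

/-- The expression `ψ ∘ f ∘ φ⁻¹` of a map in local charts. -/
def inCharts (φ ψ : OpenPartialHomeomorph M E) (f : M → M) : E → E :=
  fun u => ψ (f (φ.symm u))

variable (E) in
/-- A family of coordinates in which `C¹`-distances from `f` are measured: smooth charts
`dom i`, `cod i` of `M` and compact sets `K i` in the domain of `dom i`, forming a locally
finite family, with `f (K i)` in the domain of `cod i`. -/
structure C1Charts (f : M → M) (ι : Type*) where
  dom : ι → OpenPartialHomeomorph M E
  cod : ι → OpenPartialHomeomorph M E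
  K : ι → Set M
  dom_mem : ∀ i, dom i ∈ IsManifold.maximalAtlas 𝓘(ℝ, E) ∞ M
  cod_mem : ∀ i, cod i ∈ IsManifold.maximalAtlas 𝓘(ℝ, E) ∞ M
  isCompact : ∀ i, IsCompact (K i)
  subset_dom : ∀ i, K i ⊆ (dom i).source
  mapsTo_cod : ∀ i, MapsTo f (K i) (cod i).source
  locallyFinite : LocallyFinite K

open Classical in
/-- The `C¹`-distance `‖g - f‖_{C¹}` measured in a family of charts: the supremum over all
charts of the distances of the values and of the derivatives of the local expressions
of `f` and `g` (and `∞` if `g` does not map some `K i` into the domain of `cod i`). -/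
def C1Charts.dist {f : M → M} {ι : Type*} (𝒜 : C1Charts E f ι) (g : M → M) : ℝ≥0∞ :=
  if ∀ i, MapsTo g (𝒜.K i) (𝒜.cod i).source then
    ⨆ i, ⨆ x ∈ 𝒜.K i, max
      ‖𝒜.cod i (g x) - 𝒜.cod i (f x)‖ₑ
      ‖fderiv ℝ (inCharts (𝒜.dom i) (𝒜.cod i) g) (𝒜.dom i x)
        - fderiv ℝ (inCharts (𝒜.dom i) (𝒜.cod i) f) (𝒜.dom i x)‖ₑ
  else ⊤

/-- `B_ε(f, D)`: the Poisson `C¹`-diffeomorphisms `g` with `‖g - f‖_{C¹} < ε` and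
`g = f` on `D`. -/
def poissonBall (π : PoissonStructure E M) {f : M → M} {ι : Type*} (𝒜 : C1Charts E f ι)
    (ε : ℝ) (D : Set M) : Set (M ≃ₘ^1⟮𝓘(ℝ, E), 𝓘(ℝ, E)⟯ M) :=
  {g | IsPoissonDiffeo π g ∧ 𝒜.dist g < ENNReal.ofReal ε ∧ EqOn g f D}

end Manifold

section Coordinates

variable {d n : ℕ}

/-- The canonical Poisson structure `π₀ = ∑ᵢ ∂/∂xᵢ ∧ ∂/∂yᵢ` on `ℝ^{2d} × ℝ^n`, evaluated on
two (constant) covectors. -/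
def canonicalBivector (ξ η : PSpace d n →L[ℝ] ℝ) : ℝ :=
  ∑ i : Fin d,
    (ξ (EuclideanSpace.single (Sum.inl (Sum.inl i)) 1)
        * η (EuclideanSpace.single (Sum.inl (Sum.inr i)) 1)
      - ξ (EuclideanSpace.single (Sum.inl (Sum.inr i)) 1)
        * η (EuclideanSpace.single (Sum.inl (Sum.inl i)) 1))

variable {M : Type*} [TopologicalSpace M] [ChartedSpace (PSpace d n) M]

/-- A Darboux chart: a smooth chart `φ` of `M` with `φ_* π = π₀`. -/
def IsDarbouxChart (π : PoissonStructure (PSpace d n) M)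
    (φ : OpenPartialHomeomorph M (PSpace d n)) : Prop :=
  φ ∈ IsManifold.maximalAtlas 𝓘(ℝ, PSpace d n) ∞ M ∧
    ∀ x ∈ φ.source, ∀ ξ η : PSpace d n →L[ℝ] ℝ,
      π.bivector x (ξ.comp (mfderiv 𝓘(ℝ, PSpace d n) 𝓘(ℝ, PSpace d n) φ x))
        (η.comp (mfderiv 𝓘(ℝ, PSpace d n) 𝓘(ℝ, PSpace d n) φ x)) = canonicalBivector ξ η

/-- The matrix of the derivative at `p` of a map `f` of `M`, in the charts `φ` around `p`
and `ψ` around `f p`. -/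
def derivMatrix (φ ψ : OpenPartialHomeomorph M (PSpace d n)) (f : M → M) (p : M) :
    Matrix ((Fin d ⊕ Fin d) ⊕ Fin n) ((Fin d ⊕ Fin d) ⊕ Fin n) ℝ :=
  (Matrix.toEuclideanCLM (𝕜 := ℝ)).symm (fderiv ℝ (inCharts φ ψ f) (φ p))

/-- The block matrix `A_π = [A 0; 0 I]`. -/
def poissonExtension (n : ℕ) (A : Matrix (Fin d ⊕ Fin d) (Fin d ⊕ Fin d) ℝ) :
    Matrix ((Fin d ⊕ Fin d) ⊕ Fin n) ((Fin d ⊕ Fin d) ⊕ Fin n) ℝ :=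
  Matrix.fromBlocks A 0 0 1

/-- The matrix norm induced by the `ℓ¹`-norm: the maximum over the columns of the sum of the
absolute values of the entries (`0` for the empty matrix). -/
def colSumNorm {m : Type*} [Fintype m] (A : Matrix m m ℝ) : ℝ :=
  ⨆ j, ∑ i, |A i j|

end Coordinates

end

/-! The perturbation is `g = H ∘ f`, where `H` is a Poisson diffeomorphism supported in a small ball
of the chart `ψ` around `f p`, fixing `f p` and having derivative `A_π` there. Then `D_p g = A_π D_p
f`, so the task is to build `H` with a `C¹`-bound that does not deteriorate as the ball shrinks,
since `δ` is chosen before `V`.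

Let `P` be the constant Poisson operator and `q(w) = ⟨Q w, w⟩` with `Q` symmetric and close to the
identity. The Hamiltonian `F(c q)/2c` with `F' = cutoff` has vector field `cutoff(c q) P Q w`. It
conserves `q`, so its flow is explicit: `w ↦ exp(s cutoff(c q(w)) P Q) w`. Since `q` is positive
definite, this is the identity outside a ball of radius of order `1/√c`; at the origin the
derivative is `exp(s P Q)`. Changing `c` conjugates the flow by a homothety, which leaves the range
of its derivative unchanged: this is the uniform bound `exists_norm_twistDeriv_sub_one_le`.

A symplectic matrix near `I` has a logarithm `J S` with `S` symmetric, but `S` may be indefinite,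
and then the sublevel sets of the quadratic form are not bounded. The remedy is to factor `A = exp(η
J Q) exp(-η J)` with a fixed small `η`: as `A → I` the logarithm of `A exp(η J)` tends to `η J`, so
`Q → I` is positive definite (`eventually_exists_exp_smul_J_mul`). Both factors come from bumps, and
composing them gives `exists_isPoissonBump_poissonExtension`.

Back on `M`, only the finitely many `K i` containing `p` matter. The derivative error in charts is
governed by the bump's distance to the identity times constants at `p`, plus terms vanishing with
the radius. -/

noncomputable section

/-! ### Explicit flows of truncated quadratic Hamiltonians -/

section Twist

open NormedSpace ContinuousLinearMap
open scoped RealInnerProductSpace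

/-- A smooth function on `ℝ`, equal to `1` on `(-∞, 1/2]` and to `0` on `[1, ∞)`. -/
def cutoff (t : ℝ) : ℝ := Real.smoothTransition (2 - 2 * t)

theorem cutoff_contDiff : ContDiff ℝ ∞ cutoff :=
  Real.smoothTransition.contDiff.comp (contDiff_const.sub (contDiff_const.mul contDiff_id))

theorem cutoff_of_le {t : ℝ} (ht : t ≤ 1 / 2) : cutoff t = 1 :=
  Real.smoothTransition.one_of_one_le (by linarith)

theorem cutoff_of_ge {t : ℝ} (ht : 1 ≤ t) : cutoff t = 0 :=
  Real.smoothTransition.zero_of_nonpos (by linarith)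

theorem abs_cutoff_le (t : ℝ) : |cutoff t| ≤ 1 := by
  rw [cutoff, abs_of_nonneg (Real.smoothTransition.nonneg _)]
  exact Real.smoothTransition.le_one _

theorem deriv_cutoff_of_lt {t : ℝ} (ht : t < 1 / 2) : deriv cutoff t = 0 := by
  have : cutoff =ᶠ[𝓝 t] fun _ => (1 : ℝ) := by
    filter_upwards [Iio_mem_nhds ht] with s hs using cutoff_of_le (le_of_lt hs)
  rw [this.deriv_eq, deriv_const]

theorem deriv_cutoff_of_gt {t : ℝ} (ht : 1 < t) : deriv cutoff t = 0 := by
  have : cutoff =ᶠ[𝓝 t] fun _ => (0 : ℝ) := by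
    filter_upwards [Ioi_mem_nhds ht] with s hs using cutoff_of_ge (le_of_lt hs)
  rw [this.deriv_eq, deriv_const]

theorem exists_deriv_cutoff_bound : ∃ C : ℝ, 0 < C ∧ ∀ t, |deriv cutoff t| ≤ C := by
  have hc : Continuous (deriv cutoff) := cutoff_contDiff.continuous_deriv (by simp)
  obtain ⟨C, hC⟩ := (isCompact_Icc (a := (1 / 2 : ℝ)) (b := 1)).exists_bound_of_continuousOn
    hc.continuousOn
  refine ⟨max C 1, by positivity, fun t => ?_⟩
  by_cases h1 : t < 1 / 2
  · simp [deriv_cutoff_of_lt h1]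
  by_cases h2 : 1 < t
  · simp [deriv_cutoff_of_gt h2]
  · exact (hC t ⟨not_lt.1 h1, not_lt.1 h2⟩).trans (le_max_left _ _)

variable {E : Type*} [NormedAddCommGroup E] [InnerProductSpace ℝ E]

theorem contDiff_exp_real {𝔸 : Type*} [NormedRing 𝔸] [NormedAlgebra ℝ 𝔸] [CompleteSpace 𝔸]
    {n : WithTop ℕ∞} : ContDiff ℝ n (exp : 𝔸 → 𝔸) :=
  contDiff_iff_contDiffAt.2 fun x => (exp_analytic (𝕂 := ℝ) x).contDiffAt

theorem exp_neg_mul_exp {𝔸 : Type*} [NormedRing 𝔸] [NormedAlgebra ℝ 𝔸] [CompleteSpace 𝔸]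
    (x : 𝔸) : exp (-x) * exp x = 1 := by
  let _ : NormedAlgebra ℚ 𝔸 := NormedAlgebra.restrictScalars ℚ ℝ _
  rw [← exp_add_of_commute (Commute.neg_left (Commute.refl x)), neg_add_cancel, exp_zero]

/-- The quadratic form `⟨Q w, w⟩`. -/
def quadForm (Q : E →L[ℝ] E) (w : E) : ℝ := ⟪Q w, w⟫

theorem quadForm_contDiff (Q : E →L[ℝ] E) : ContDiff ℝ ∞ (quadForm Q) :=
  Q.contDiff.inner ℝ contDiff_id

/-- The time-`s` flow of the Hamiltonian `F (c⟨Q w, w⟩) / 2c`, with `F' = cutoff`, for the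
linear Poisson structure given by the skew map `P`. -/
def twist (P Q : E →L[ℝ] E) (c s : ℝ) (w : E) : E :=
  exp ((s * cutoff (c * quadForm Q w)) • (P * Q)) w

/-- The derivative of `twist P Q c s` at `w`. -/
def twistDeriv (P Q : E →L[ℝ] E) (c s : ℝ) (w : E) : E →L[ℝ] E :=
  exp ((s * cutoff (c * quadForm Q w)) • (P * Q)) *
    (1 + (s * deriv cutoff (c * quadForm Q w) * (2 * c)) •
      (innerSL ℝ (Q w)).smulRight (P (Q w)))

theorem twist_of_le {P Q : E →L[ℝ] E} {c : ℝ} (s : ℝ) {w : E} (hw : 1 ≤ c * quadForm Q w) :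
    twist P Q c s w = w := by
  simp [twist, cutoff_of_ge hw]

@[simp]
theorem twist_zero (P Q : E →L[ℝ] E) (c s : ℝ) : twist P Q c s 0 = 0 := by
  simp [twist]

theorem twistDeriv_zero (P Q : E →L[ℝ] E) (c s : ℝ) :
    twistDeriv P Q c s 0 = exp (s • (P * Q)) := by
  have : cutoff 0 = 1 := cutoff_of_le (by norm_num)
  ext v
  simp [twistDeriv, quadForm, this]

variable [CompleteSpace E]

theorem quadForm_hasFDerivAt {Q : E →L[ℝ] E} (hQ : IsSelfAdjoint Q) (w : E) :
    HasFDerivAt (quadForm Q) ((2 : ℝ) • innerSL ℝ (Q w)) w := by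
  convert! Q.hasFDerivAt.inner ℝ (hasFDerivAt_id w) using 1
  ext v
  have h1 : ⟪Q v, w⟫ = ⟪v, Q w⟫ := by
    rw [← adjoint_inner_right, ← star_eq_adjoint, hQ.star_eq]
  simp [h1, real_inner_comm v, two_mul]

/-- With `R = exp (t P Q)`, the identity `Q (P Q) = (Q P) Q` gives `Q R = exp (t Q P) Q`, while `R*
= exp (-t Q P)`. Hence `R* Q R = Q`. -/
theorem exp_smul_mul_quadForm {P Q : E →L[ℝ] E} (hP : star P = -P) (hQ : IsSelfAdjoint Q)
    (t : ℝ) (w : E) : quadForm Q (exp (t • (P * Q)) w) = quadForm Q w := by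
  let _ : NormedAlgebra ℚ (E →L[ℝ] E) := NormedAlgebra.restrictScalars ℚ ℝ _
  have h1 : SemiconjBy Q (t • (P * Q)) (t • (Q * P)) := by
    simp [SemiconjBy, mul_assoc]
  have h2 : star (exp (t • (P * Q))) = exp (-(t • (Q * P))) := by
    rw [star_exp]
    simp [hP, hQ.star_eq]
  have h3 := h1.exp_neg_mul_mul_exp_eq_self
  rw [← h2] at h3
  unfold quadForm
  conv_rhs => rw [← h3]
  simp only [mul_apply_eq_comp, star_eq_adjoint, adjoint_inner_left]

theorem twist_contDiff (P Q : E →L[ℝ] E) (c s : ℝ) : ContDiff ℝ ∞ (twist P Q c s) := by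
  refine ContDiff.clm_apply (contDiff_exp_real.comp ?_) contDiff_id
  exact (contDiff_const.mul (cutoff_contDiff.comp
    (contDiff_const.mul (quadForm_contDiff Q)))).smul contDiff_const

theorem twist_hasFDerivAt {P Q : E →L[ℝ] E} (hQ : IsSelfAdjoint Q) (c s : ℝ) (w : E) :
    HasFDerivAt (twist P Q c s) (twistDeriv P Q c s w) w := by
  have h1 : HasFDerivAt (fun w => s * cutoff (c * quadForm Q w))
      ((s * deriv cutoff (c * quadForm Q w) * (2 * c)) • innerSL ℝ (Q w)) w := by
    have h := ((cutoff_contDiff.differentiable (by simp)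
      (c * quadForm Q w)).hasDerivAt.comp_hasFDerivAt w
        ((quadForm_hasFDerivAt hQ w).const_mul c)).const_mul s
    convert! h using 1
    simp only [smul_smul]
    congr 1
    ring
  have h2 := (hasDerivAt_exp_smul_const (𝕂 := ℝ) (P * Q)
    (s * cutoff (c * quadForm Q w))).hasFDerivAt.comp w h1
  have h3 := h2.clm_apply (hasFDerivAt_id w)
  convert! h3 using 1
  ext v
  simp [twistDeriv, mul_comm, smul_smul]

theorem quadForm_twist {P Q : E →L[ℝ] E} (hP : star P = -P) (hQ : IsSelfAdjoint Q)
    (c s : ℝ) (w : E) : quadForm Q (twist P Q c s w) = quadForm Q w :=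
  exp_smul_mul_quadForm hP hQ _ w

/-- Conservation of the quadratic form makes the cutoff factor the same at `w` and at its image, so
the two exponentials cancel. -/
theorem twist_neg_twist {P Q : E →L[ℝ] E} (hP : star P = -P) (hQ : IsSelfAdjoint Q)
    (c s : ℝ) (w : E) : twist P Q c (-s) (twist P Q c s w) = w := by
  rw [twist, quadForm_twist hP hQ, twist, ← mul_apply_eq_comp, neg_mul, neg_smul,
    exp_neg_mul_exp, one_apply_eq_self]

/-- The derivative is a product of two maps that each preserve `P`: the exponential, and a
transvection `1 + b ⟨u, ·⟩ P u` with `u = Q w`. For the latter the terms linear in `b` cancel by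
skewness of `P`, and the quadratic one vanishes because `⟨u, P u⟩ = 0`. Invertibility of `P` is not
needed, so degenerate Poisson structures are covered. -/
theorem twistDeriv_mul_mul_star {P Q : E →L[ℝ] E} (hP : star P = -P) (hQ : IsSelfAdjoint Q)
    (c s : ℝ) (w : E) : twistDeriv P Q c s w * P * star (twistDeriv P Q c s w) = P := by
  let _ : NormedAlgebra ℚ (E →L[ℝ] E) := NormedAlgebra.restrictScalars ℚ ℝ _
  rw [twistDeriv]
  set t := s * cutoff (c * quadForm Q w)
  set b := s * deriv cutoff (c * quadForm Q w) * (2 * c)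
  set u := Q w
  have hR : exp (t • (P * Q)) * P * star (exp (t • (P * Q))) = P := by
    have h1 : SemiconjBy P (-(t • (Q * P))) (-(t • (P * Q))) := by
      simp [SemiconjBy, mul_assoc]
    have h2 : star (exp (t • (P * Q))) = exp (-(t • (Q * P))) := by
      rw [star_exp]
      simp [hP, hQ.star_eq]
    have h3 := h1.exp_neg_mul_mul_exp_eq_self
    rwa [neg_neg, ← h2] at h3
  have hskew : ∀ x y : E, ⟪x, P y⟫ = -⟪P x, y⟫ := by
    intro x y
    rw [← adjoint_inner_left, ← star_eq_adjoint, hP]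
    simp
  have hstar : star ((innerSL ℝ u).smulRight (P u)) = (innerSL ℝ (P u)).smulRight u := by
    rw [star_eq_adjoint]
    symm
    rw [eq_adjoint_iff]
    intro x y
    simp [inner_smul_left, inner_smul_right, real_inner_comm]
    ring
  have huu : ⟪u, P u⟫ = 0 := by
    have := hskew u u
    rw [real_inner_comm u (P u)] at this
    linarith
  have hT : (1 + b • (innerSL ℝ u).smulRight (P u)) * P *
      star (1 + b • (innerSL ℝ u).smulRight (P u)) = P := by
    rw [star_add, star_smul, hstar, star_one]
    ext v
    simp [inner_add_right, inner_smul_right, hskew u v, huu]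
  calc _ = exp (t • (P * Q)) * ((1 + b • (innerSL ℝ u).smulRight (P u)) * P *
      star (1 + b • (innerSL ℝ u).smulRight (P u))) * star (exp (t • (P * Q))) := by
        rw [star_mul]; simp only [mul_assoc]
    _ = P := by rw [hT, hR]

/-- The derivative of `twist P Q c s` is close to the identity for small `s`, uniformly in `c`
and in the quadratic forms `Q` close to the standard one. -/
theorem exists_norm_twistDeriv_sub_one_le (P : E →L[ℝ] E) {κ : ℝ} (hκ : 0 < κ) :
    ∃ s₀ : ℝ, 0 < s₀ ∧ ∀ (s c : ℝ) (Q : E →L[ℝ] E) (w : E), |s| ≤ s₀ → 0 < c → ‖Q‖ ≤ 2 →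
      (∀ w, ‖w‖ ^ 2 / 2 ≤ quadForm Q w) → ‖twistDeriv P Q c s w - 1‖ ≤ κ := by
  let _ : NormedAlgebra ℚ (E →L[ℝ] E) := NormedAlgebra.restrictScalars ℚ ℝ _
  obtain ⟨C, hC0, hC⟩ := exists_deriv_cutoff_bound
  -- The derivative is `R (1 + T)`. The budget is `‖R - 1‖ ≤ min 1 (κ/2)` and `‖T‖ ≤ κ/4`, so that
  -- `(R - 1) + (R - 1) T + T` has norm at most `κ`.
  set κ₁ := min 1 (κ / 2) with hκ₁
  have hκ₁pos : 0 < κ₁ := by positivity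
  obtain ⟨ρ, hρ, hexp⟩ := Metric.continuousAt_iff.1
    ((exp_continuous (𝔸 := E →L[ℝ] E)).continuousAt (x := 0)) κ₁ hκ₁pos
  refine ⟨min (ρ / (4 * (‖P‖ + 1))) (κ / (4 * (C * 16 * (‖P‖ + 1)))), by positivity, ?_⟩
  intro s c Q w hs hc hQ hpos
  have hs1 := hs.trans (min_le_left _ _)
  have hs2 := hs.trans (min_le_right _ _)
  set t := s * cutoff (c * quadForm Q w) with ht
  set R := exp (t • (P * Q)) with hR
  have hPQ : ‖P * Q‖ ≤ 2 * ‖P‖ := (norm_mul_le _ _).trans (by nlinarith [norm_nonneg P])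
  have hRn : ‖R - 1‖ ≤ κ₁ := by
    have h1 : ‖t • (P * Q)‖ < ρ := by
      rw [norm_smul, Real.norm_eq_abs, ht, abs_mul]
      have h2 : |s| * |cutoff (c * quadForm Q w)| ≤ |s| :=
        mul_le_of_le_one_right (abs_nonneg _) (abs_cutoff_le _)
      calc _ ≤ |s| * (2 * ‖P‖) := by gcongr
        _ ≤ ρ / (4 * (‖P‖ + 1)) * (2 * ‖P‖) := by gcongr
        _ < ρ := by
          rw [div_mul_eq_mul_div, div_lt_iff₀ (by positivity)]
          nlinarith [norm_nonneg P]
    have := hexp (x := t • (P * Q)) (by rwa [dist_zero_right])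
    rw [exp_zero, dist_eq_norm] at this
    exact this.le
  set T := (s * deriv cutoff (c * quadForm Q w) * (2 * c)) •
      (innerSL ℝ (Q w)).smulRight (P (Q w)) with hT
  have hTn : ‖T‖ ≤ κ / 4 := by
    by_cases h1 : 1 < c * quadForm Q w
    · simp [hT, deriv_cutoff_of_gt h1]
      positivity
    -- Where the derivative of the cutoff can be nonzero, `‖w‖²` is at most `2 / c`. This absorbs
    -- the factor `c` in `T` and makes the bound uniform in `c`.
    · have h2 : c * ‖w‖ ^ 2 ≤ 2 := by nlinarith [hpos w]
      have hQw : ‖Q w‖ ≤ 2 * ‖w‖ := Q.le_of_opNorm_le hQ w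
      have hPw : ‖P (Q w)‖ ≤ ‖P‖ * (2 * ‖w‖) := P.le_opNorm_of_le hQw
      have h3 : ‖(innerSL ℝ (Q w)).smulRight (P (Q w))‖ ≤ 2 * ‖w‖ * (‖P‖ * (2 * ‖w‖)) := by
        rw [norm_smulRight_apply, innerSL_apply_norm]
        gcongr
      have hPn := norm_nonneg P
      calc ‖T‖ = |s| * |deriv cutoff (c * quadForm Q w)| * (2 * c) *
            ‖(innerSL ℝ (Q w)).smulRight (P (Q w))‖ := by
            rw [hT, norm_smul, Real.norm_eq_abs, abs_mul, abs_mul, abs_of_pos (a := 2 * c)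
              (by positivity)]
        _ ≤ |s| * C * (2 * c) * (2 * ‖w‖ * (‖P‖ * (2 * ‖w‖))) := by
            gcongr
            exact hC _
        _ = |s| * (C * 8 * ‖P‖) * (c * ‖w‖ ^ 2) := by ring
        _ ≤ |s| * (C * 8 * ‖P‖) * 2 := by gcongr
        _ ≤ κ / (4 * (C * 16 * (‖P‖ + 1))) * (C * 8 * ‖P‖) * 2 := by gcongr
        _ ≤ κ / 4 := by
          rw [div_mul_eq_mul_div, div_mul_eq_mul_div, div_le_div_iff₀ (by positivity)
            (by positivity)]
          nlinarith [mul_pos hκ hC0]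
  have hdec : twistDeriv P Q c s w - 1 = (R - 1) + ((R - 1) * T + T) := by
    rw [twistDeriv, ← hT, ← ht, ← hR]
    noncomm_ring
  rw [hdec]
  calc _ ≤ ‖R - 1‖ + (‖R - 1‖ * ‖T‖ + ‖T‖) :=
        (norm_add_le _ _).trans (add_le_add le_rfl
          ((norm_add_le _ _).trans (add_le_add (norm_mul_le _ _) le_rfl)))
    _ ≤ κ / 2 + (1 * (κ / 4) + κ / 4) := by
        gcongr
        · exact hRn.trans (min_le_right _ _)
        · exact hRn.trans (min_le_left _ _)
    _ = κ := by ring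

end Twist

/-! ### Factoring symplectic matrices near the identity -/

section SymplecticLog

open NormedSpace Matrix Filter
open scoped Matrix.Norms.Operator

variable {l : Type*} [Fintype l] [DecidableEq l]

theorem exp_smul_J_mem_symplecticGroup (η : ℝ) :
    exp (η • J l ℝ) ∈ symplecticGroup l ℝ := by
  rw [SymplecticGroup.mem_iff, ← exp_transpose, transpose_smul, J_transpose, smul_neg]
  have h : SemiconjBy (J l ℝ) (-(η • J l ℝ)) (-(η • J l ℝ)) := by
    simp [SemiconjBy]
  have h2 := h.exp_neg_mul_mul_exp_eq_self
  rw [neg_neg] at h2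
  exact h2

/-- The exponential of `X` is symplectic and `X` is small: then `X` is Hamiltonian. -/
theorem eq_J_mul_transpose_mul_J_of_exp_mem {S : Set (Matrix (l ⊕ l) (l ⊕ l) ℝ)}
    (hS : InjOn exp S) {X : Matrix (l ⊕ l) (l ⊕ l) ℝ} (hX : exp X ∈ symplecticGroup l ℝ)
    (h1 : -X ∈ S) (h2 : -(J l ℝ * Xᵀ * J l ℝ) ∈ S) : X = J l ℝ * Xᵀ * J l ℝ := by
  refine neg_injective (hS h1 h2 ?_)
  have hJ : IsUnit (J l ℝ) := (isUnit_iff_isUnit_det _).2 (isUnit_det_J _ _)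
  -- Symplecticity says that this conjugate of `(exp X)ᵀ` is the inverse of `exp X`, that is, `exp
  -- (-X)`. Injectivity of `exp` on `S` then compares the exponents.
  have h3 : exp (-(J l ℝ * Xᵀ * J l ℝ)) = J l ℝ * exp Xᵀ * (J l ℝ)⁻¹ := by
    rw [← exp_conj _ _ hJ, J_inv, mul_neg]
  rw [h3, exp_transpose, J_inv, Matrix.exp_neg]
  have h4 := SymplecticGroup.inv_left_mul_aux hX
  refine inv_eq_left_inv ?_
  rw [← h4]
  noncomm_ring

/-- A symplectic matrix near the identity is `exp (η J Q) exp (-η J)` with `Q` a symmetric matrix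
near the identity. -/
theorem eventually_exists_exp_smul_J_mul (N : Set (Matrix (l ⊕ l) (l ⊕ l) ℝ)) (hN : N ∈ 𝓝 1) :
    ∀ᶠ η : ℝ in 𝓝[>] 0, ∀ᶠ A : Matrix (l ⊕ l) (l ⊕ l) ℝ in 𝓝 1, A ∈ symplecticGroup l ℝ →
      ∃ Q ∈ N, Qᵀ = Q ∧ exp (η • (J l ℝ * Q)) = A * exp (η • J l ℝ) := by
  have hd : HasStrictFDerivAt (exp : Matrix (l ⊕ l) (l ⊕ l) ℝ → _)
      ((ContinuousLinearEquiv.refl ℝ (Matrix (l ⊕ l) (l ⊕ l) ℝ) :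
        Matrix (l ⊕ l) (l ⊕ l) ℝ →L[ℝ] _)) 0 :=
    hasStrictFDerivAt_exp_zero (𝕂 := ℝ)
  set e := hd.toOpenPartialHomeomorph exp with he
  have hcoe : (e : _ → _) = exp := hd.toOpenPartialHomeomorph_coe
  have h0 : (0 : Matrix (l ⊕ l) (l ⊕ l) ℝ) ∈ e.source :=
    hd.mem_toOpenPartialHomeomorph_source
  have hinj : InjOn exp e.source := hcoe ▸ e.injOn
  have hnhds : e.source ∈ 𝓝 (0 : Matrix (l ⊕ l) (l ⊕ l) ℝ) := e.open_source.mem_nhds h0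
  have hlim : ∀ a : ℝ, Tendsto (fun η : ℝ => (a * η) • J l ℝ) (𝓝[>] 0) (𝓝 0) := by
    intro a
    have : Continuous fun η : ℝ => (a * η) • J l ℝ := by fun_prop
    simpa using (this.tendsto 0).mono_left nhdsWithin_le_nhds
  filter_upwards [(hlim 1).eventually hnhds, (hlim (-1)).eventually hnhds,
    self_mem_nhdsWithin] with η h1 h2 hη
  have hη : 0 < η := hη
  rw [one_mul] at h1
  rw [neg_one_mul, neg_smul] at h2
  have hc : ContinuousAt (fun A => e.symm (A * exp (η • J l ℝ))) 1 := by
    refine ContinuousAt.comp (e.continuousAt_symm ?_) (by fun_prop)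
    rw [one_mul, ← hcoe]
    exact e.map_source h1
  have hX1 : e.symm (1 * exp (η • J l ℝ)) = η • J l ℝ := by
    rw [one_mul, ← hcoe, e.left_inv h1]
  have hJJ : J l ℝ * (J l ℝ)ᵀ * J l ℝ = J l ℝ := by
    rw [J_transpose, mul_neg, J_squared, neg_neg, one_mul]
  have ht : Tendsto (fun A => e.symm (A * exp (η • J l ℝ))) (𝓝 1) (𝓝 (η • J l ℝ)) := by
    have := hc.tendsto
    rwa [hX1] at this
  have ht1 : ∀ᶠ A in 𝓝 1, -e.symm (A * exp (η • J l ℝ)) ∈ e.source :=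
    ht.neg.eventually (e.open_source.mem_nhds h2)
  have ht2 : ∀ᶠ A in 𝓝 1,
      -(J l ℝ * (e.symm (A * exp (η • J l ℝ)))ᵀ * J l ℝ) ∈ e.source := by
    have hcont : Continuous fun X : Matrix (l ⊕ l) (l ⊕ l) ℝ => -(J l ℝ * Xᵀ * J l ℝ) := by
      fun_prop
    refine ((hcont.tendsto _).comp ht).eventually (e.open_source.mem_nhds ?_)
    rwa [transpose_smul, mul_smul_comm, smul_mul_assoc, hJJ]
  -- Solving `η J Q = X` with `J² = -1` gives `Q = -η⁻¹ J X`. As `A → 1` with `η` fixed, `X → η J`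
  -- and hence `Q → 1`.
  have ht3 : ∀ᶠ A in 𝓝 1, (-η⁻¹) • (J l ℝ * e.symm (A * exp (η • J l ℝ))) ∈ N := by
    have hcont : Continuous fun X : Matrix (l ⊕ l) (l ⊕ l) ℝ => (-η⁻¹) • (J l ℝ * X) := by
      fun_prop
    refine ((hcont.tendsto _).comp ht).eventually ?_
    rw [mul_smul_comm, smul_smul, J_squared, neg_mul, inv_mul_cancel₀ hη.ne', neg_smul, one_smul,
      neg_neg]
    exact hN
  have ht4 : ∀ᶠ A in 𝓝 1, A * exp (η • J l ℝ) ∈ e.target := by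
    have hcont : Continuous fun A : Matrix (l ⊕ l) (l ⊕ l) ℝ => A * exp (η • J l ℝ) := by
      fun_prop
    refine (hcont.tendsto _).eventually (e.open_target.mem_nhds ?_)
    rw [one_mul, ← hcoe]
    exact e.map_source h1
  filter_upwards [ht1, ht2, ht3, ht4] with A hA1 hA2 hA3 hA4 hA
  set X := e.symm (A * exp (η • J l ℝ)) with hX
  have hexp : exp X = A * exp (η • J l ℝ) := by
    rw [← hcoe, hX, e.right_inv hA4, hcoe]
  have hham := eq_J_mul_transpose_mul_J_of_exp_mem hinj
    (hexp ▸ mul_mem hA (exp_smul_J_mem_symplecticGroup η)) hA1 hA2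
  refine ⟨_, hA3, ?_, ?_⟩
  · rw [transpose_smul, transpose_mul, J_transpose]
    congr 1
    conv_rhs => rw [hham]
    rw [← mul_assoc, ← mul_assoc, J_squared]
    noncomm_ring
  · rw [← hexp, mul_smul_comm, ← mul_assoc, J_squared, smul_smul]
    congr 1
    simp [hη.ne']

end SymplecticLog

/-! ### Compactly supported Poisson bumps on the model space -/

section PoissonBump

open NormedSpace ContinuousLinearMap
open scoped RealInnerProductSpace

variable {E : Type*} [NormedAddCommGroup E] [InnerProductSpace ℝ E] [CompleteSpace E]

/-- A smooth diffeomorphism of `E`, supported in the ball of radius `r`, fixing the origin,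
`C¹`-close to the identity and preserving the constant bivector `P`. -/
structure IsPoissonBump (P : E →L[ℝ] E) (r κ : ℝ) (h : E ≃ E) : Prop where
  contDiff : ContDiff ℝ ∞ h
  contDiff_symm : ContDiff ℝ ∞ h.symm
  eq_self : ∀ w, r ≤ ‖w‖ → h w = w
  map_zero : h 0 = 0
  norm_fderiv_sub_le : ∀ w, ‖fderiv ℝ h w - 1‖ ≤ κ
  poisson : ∀ w, fderiv ℝ h w * P * star (fderiv ℝ h w) = P

namespace IsPoissonBump

variable {P : E →L[ℝ] E} {r κ κ' : ℝ} {h h' : E ≃ E}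

theorem differentiable (hh : IsPoissonBump P r κ h) : Differentiable ℝ h :=
  hh.contDiff.differentiable (by simp)

theorem fderiv_trans (hh : IsPoissonBump P r κ h) (hh' : IsPoissonBump P r κ' h') (w : E) :
    fderiv ℝ (h.trans h') w = fderiv ℝ h' (h w) * fderiv ℝ h w :=
  fderiv_comp w hh'.differentiable.differentiableAt hh.differentiable.differentiableAt

theorem trans (hh : IsPoissonBump P r κ h) (hh' : IsPoissonBump P r κ' h') :
    IsPoissonBump P r (κ' * κ + κ' + κ) (h.trans h') where
  contDiff := hh'.contDiff.comp hh.contDiff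
  contDiff_symm := hh.contDiff_symm.comp hh'.contDiff_symm
  eq_self w hw := by simp [hh.eq_self w hw, hh'.eq_self w hw]
  map_zero := by simp [hh.map_zero, hh'.map_zero]
  norm_fderiv_sub_le w := by
    rw [hh.fderiv_trans hh']
    have h1 := hh.norm_fderiv_sub_le w
    have h2 := hh'.norm_fderiv_sub_le (h w)
    have h3 : fderiv ℝ h' (h w) * fderiv ℝ h w - 1 =
        (fderiv ℝ h' (h w) - 1) * (fderiv ℝ h w - 1) + (fderiv ℝ h' (h w) - 1) +
          (fderiv ℝ h w - 1) := by noncomm_ring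
    rw [h3]
    refine (norm_add₃_le).trans (add_le_add (add_le_add ?_ h2) h1)
    exact (norm_mul_le _ _).trans
      (mul_le_mul h2 h1 (norm_nonneg _) ((norm_nonneg _).trans h2))
  poisson w := by
    rw [hh.fderiv_trans hh', star_mul]
    calc _ = fderiv ℝ h' (h w) * (fderiv ℝ h w * P * star (fderiv ℝ h w)) *
          star (fderiv ℝ h' (h w)) := by simp only [mul_assoc]
      _ = P := by rw [hh.poisson, hh'.poisson]

end IsPoissonBump

/-- `twist P Q c s` as a bijection. -/
def twistEquiv {P Q : E →L[ℝ] E} (hP : star P = -P) (hQ : IsSelfAdjoint Q) (c s : ℝ) : E ≃ E where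
  toFun := twist P Q c s
  invFun := twist P Q c (-s)
  left_inv := twist_neg_twist hP hQ c s
  right_inv w := by simpa using twist_neg_twist hP hQ c (-s) w

/-- The bump is the twist with `c = 2 / r²`. Closeness of `Q` to the identity yields `q(w) ≥ ‖w‖² /
2`, so `c q ≥ 1` and the cutoff vanishes once `‖w‖ ≥ r`. The threshold `s₀` does not depend on `r`.
-/
theorem exists_isPoissonBump_exp {P : E →L[ℝ] E} (hP : star P = -P) {κ : ℝ} (hκ : 0 < κ) :
    ∃ s₀ : ℝ, 0 < s₀ ∧ ∀ (s r : ℝ) (Q : E →L[ℝ] E), |s| ≤ s₀ → 0 < r → IsSelfAdjoint Q →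
      ‖Q - 1‖ ≤ 1 / 2 →
        ∃ h : E ≃ E, IsPoissonBump P r κ h ∧ fderiv ℝ h 0 = exp (s • (P * Q)) := by
  obtain ⟨s₀, hs₀, H⟩ := exists_norm_twistDeriv_sub_one_le P hκ
  refine ⟨s₀, hs₀, fun s r Q hs hr hQ hQ1 => ?_⟩
  have hQn : ‖Q‖ ≤ 2 := by
    have h1 : ‖(1 : E →L[ℝ] E)‖ ≤ 1 := ContinuousLinearMap.norm_id_le
    have h2 := norm_add_le (Q - 1) 1
    rw [sub_add_cancel] at h2
    linarith
  have hpos : ∀ w, ‖w‖ ^ 2 / 2 ≤ quadForm Q w := by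
    intro w
    have h1 : ‖(Q - 1) w‖ ≤ 1 / 2 * ‖w‖ := (Q - 1).le_of_opNorm_le hQ1 w
    have h2 := neg_le_of_abs_le (abs_real_inner_le_norm ((Q - 1) w) w)
    have h3 : quadForm Q w = ⟪(Q - 1) w, w⟫ + ‖w‖ ^ 2 := by
      simp [quadForm, inner_sub_left]
    nlinarith [norm_nonneg w]
  have hd := twist_hasFDerivAt (P := P) hQ (2 / r ^ 2) s
  have hfd : ∀ w, fderiv ℝ (twistEquiv hP hQ (2 / r ^ 2) s) w = twistDeriv P Q (2 / r ^ 2) s w :=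
    fun w => (hd w).fderiv
  refine ⟨twistEquiv hP hQ (2 / r ^ 2) s, ⟨twist_contDiff _ _ _ _, twist_contDiff _ _ _ _,
    fun w hw => twist_of_le s ?_, twist_zero _ _ _ _, fun w => ?_, fun w => ?_⟩, ?_⟩
  · have h1 : r ^ 2 ≤ ‖w‖ ^ 2 := by gcongr
    rw [div_mul_eq_mul_div, le_div_iff₀ (by positivity)]
    linarith [hpos w]
  · rw [hfd]
    exact H s _ Q w hs (by positivity) hQn hpos
  · rw [hfd]
    exact twistDeriv_mul_mul_star hP hQ _ _ _
  · rw [hfd, twistDeriv_zero]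

end PoissonBump

theorem exists_colSumNorm_lt_imp_mem {m : Type*} [Fintype m] {U : Set (Matrix m m ℝ)}
    {A₀ : Matrix m m ℝ} (hU : U ∈ 𝓝 A₀) :
    ∃ δ : ℝ, 0 < δ ∧ ∀ A : Matrix m m ℝ, colSumNorm (A - A₀) < δ → A ∈ U := by
  obtain ⟨δ, hδ, h⟩ := (Metric.mem_nhds_iff (α := m → m → ℝ) (x := A₀) (s := U)).1 hU
  refine ⟨δ, hδ, fun A hA => h ?_⟩
  refine (dist_pi_lt_iff (X := fun _ : m => m → ℝ) hδ).2 fun i =>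
    (dist_pi_lt_iff hδ).2 fun j => lt_of_le_of_lt ?_ hA
  calc dist (A i j) (A₀ i j) = |(A - A₀) i j| := by rw [Real.dist_eq, Matrix.sub_apply]
    _ ≤ ∑ i, |(A - A₀) i j| :=
      Finset.single_le_sum (f := fun i => |(A - A₀) i j|) (fun _ _ => abs_nonneg _)
        (Finset.mem_univ i)
    _ ≤ colSumNorm (A - A₀) :=
      le_ciSup (f := fun j => ∑ i, |(A - A₀) i j|) (Set.finite_range _).bddAbove j

theorem exp_prodMk_zero {𝔸 𝔹 : Type*} [NormedRing 𝔸] [NormedAlgebra ℝ 𝔸] [CompleteSpace 𝔸]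
    [NormedRing 𝔹] [NormedAlgebra ℝ 𝔹] [CompleteSpace 𝔹] (a : 𝔸) :
    NormedSpace.exp (a, (0 : 𝔹)) = (NormedSpace.exp a, 1) := by
  let _ : NormedAlgebra ℚ 𝔸 := NormedAlgebra.restrictScalars ℚ ℝ _
  let _ : NormedAlgebra ℚ 𝔹 := NormedAlgebra.restrictScalars ℚ ℝ _
  refine Prod.ext (Prod.fst_exp _) ?_
  rw [Prod.snd_exp]
  exact NormedSpace.exp_zero

/-! ### The canonical Poisson structure and the realization of `A_π` -/

section Coordinates

open NormedSpace Matrix Filter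
open scoped RealInnerProductSpace Matrix.Norms.Operator

variable {d n : ℕ}

/-- The operator with block-diagonal matrix `(a, b)`. -/
def blockOp (d n : ℕ) :
    Matrix (Fin d ⊕ Fin d) (Fin d ⊕ Fin d) ℝ × Matrix (Fin n) (Fin n) ℝ →+*
      (PSpace d n →L[ℝ] PSpace d n) where
  toFun ab := toEuclideanCLM (𝕜 := ℝ) (fromBlocks ab.1 0 0 ab.2)
  map_one' := by simp
  map_mul' a b := by rw [← map_mul]; simp [fromBlocks_multiply]
  map_zero' := by simp
  map_add' a b := by rw [← map_add]; simp [fromBlocks_add]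

theorem blockOp_apply (a : Matrix (Fin d ⊕ Fin d) (Fin d ⊕ Fin d) ℝ)
    (b : Matrix (Fin n) (Fin n) ℝ) :
    blockOp d n (a, b) = toEuclideanCLM (𝕜 := ℝ) (fromBlocks a 0 0 b) := rfl

theorem blockOp_smul (t : ℝ) (ab) : blockOp d n (t • ab) = t • blockOp d n ab := by
  change toEuclideanCLM (𝕜 := ℝ) _ = t • toEuclideanCLM (𝕜 := ℝ) _
  rw [← map_smul, fromBlocks_smul]
  simp

theorem blockOp_transpose (a : Matrix (Fin d ⊕ Fin d) (Fin d ⊕ Fin d) ℝ)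
    (b : Matrix (Fin n) (Fin n) ℝ) :
    star (blockOp d n (a, b)) = blockOp d n (aᵀ, bᵀ) := by
  rw [blockOp_apply, blockOp_apply, ← map_star, star_eq_conjTranspose, fromBlocks_conjTranspose]
  simp

theorem continuous_blockOp : Continuous (blockOp d n) := by
  let L : (Matrix (Fin d ⊕ Fin d) (Fin d ⊕ Fin d) ℝ × Matrix (Fin n) (Fin n) ℝ) →ₗ[ℝ]
      (PSpace d n →L[ℝ] PSpace d n) :=
    { toFun := blockOp d n
      map_add' := map_add _
      map_smul' := blockOp_smul }
  exact L.continuous_of_finiteDimensional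

theorem exp_blockOp (a : Matrix (Fin d ⊕ Fin d) (Fin d ⊕ Fin d) ℝ) :
    exp (blockOp d n (a, 0)) = blockOp d n (exp a, 1) := by
  let _ : NormedAlgebra ℚ (Matrix (Fin d ⊕ Fin d) (Fin d ⊕ Fin d) ℝ) :=
    NormedAlgebra.restrictScalars ℚ ℝ _
  let _ : NormedAlgebra ℚ (Matrix (Fin n) (Fin n) ℝ) := NormedAlgebra.restrictScalars ℚ ℝ _
  let _ : NormedAlgebra ℚ (PSpace d n →L[ℝ] PSpace d n) :=
    NormedAlgebra.restrictScalars ℚ ℝ _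
  have h1 := NormedSpace.map_exp (blockOp d n) continuous_blockOp (a, 0)
  exact h1.symm.trans (congrArg (blockOp d n) (exp_prodMk_zero a))

/-- The constant bivector `π₀` as an operator, up to sign. -/
def poissonOp (d n : ℕ) : PSpace d n →L[ℝ] PSpace d n := blockOp d n (J (Fin d) ℝ, 0)

theorem star_poissonOp : star (poissonOp d n) = -poissonOp d n := by
  rw [poissonOp, blockOp_transpose, J_transpose, ← map_neg]
  simp

theorem canonicalBivector_eq_inner (ξ η : PSpace d n →L[ℝ] ℝ) :
    canonicalBivector ξ η = -⟪(InnerProductSpace.toDual ℝ (PSpace d n)).symm ξ,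
      poissonOp d n ((InnerProductSpace.toDual ℝ (PSpace d n)).symm η)⟫ := by
  obtain ⟨a, rfl⟩ := (InnerProductSpace.toDual ℝ (PSpace d n)).surjective ξ
  obtain ⟨b, rfl⟩ := (InnerProductSpace.toDual ℝ (PSpace d n)).surjective η
  rw [LinearIsometryEquiv.symm_apply_apply, LinearIsometryEquiv.symm_apply_apply, poissonOp,
    blockOp_apply, inner_toEuclideanCLM]
  simp only [canonicalBivector, InnerProductSpace.toDual_apply_apply,
    EuclideanSpace.inner_single_right, one_mul, conj_trivial, Finset.sum_sub_distrib]
  simp [dotProduct, mulVec, J, Matrix.one_apply]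
  ring

/-- Under the Riesz isomorphism, pulling a covector back by `D` is applying `D*`, so invariance of
the bivector becomes the operator identity `D P D* = P`. -/
theorem canonicalBivector_comp {D : PSpace d n →L[ℝ] PSpace d n}
    (hD : D * poissonOp d n * star D = poissonOp d n) (ξ η : PSpace d n →L[ℝ] ℝ) :
    canonicalBivector (ξ.comp D) (η.comp D) = canonicalBivector ξ η := by
  have h1 : ∀ ξ : PSpace d n →L[ℝ] ℝ, (InnerProductSpace.toDual ℝ (PSpace d n)).symm (ξ.comp D) =
      star D ((InnerProductSpace.toDual ℝ (PSpace d n)).symm ξ) := by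
    intro ξ
    refine ext_inner_right ℝ fun v => ?_
    rw [ContinuousLinearMap.star_eq_adjoint, ContinuousLinearMap.adjoint_inner_left]
    simp
  rw [canonicalBivector_eq_inner, canonicalBivector_eq_inner, h1, h1]
  conv_rhs => rw [← hD]
  rw [ContinuousLinearMap.star_eq_adjoint, ContinuousLinearMap.adjoint_inner_left]
  simp

/-- Symplectic matrices near the identity are derivatives at the origin of Poisson
diffeomorphisms of arbitrarily small support, with a uniform `C¹`-bound. -/
theorem exists_isPoissonBump_poissonExtension (d n : ℕ) {κ : ℝ} (hκ : 0 < κ) :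
    ∃ δ : ℝ, 0 < δ ∧ ∀ A ∈ symplecticGroup (Fin d) ℝ, colSumNorm (A - 1) < δ →
      ∀ r : ℝ, 0 < r → ∃ h : PSpace d n ≃ PSpace d n, IsPoissonBump (poissonOp d n) r κ h ∧
        fderiv ℝ h 0 = toEuclideanCLM (𝕜 := ℝ) (poissonExtension n A) := by
  -- Composing two bumps of size `κ₁` costs `κ₁² + 2 κ₁ ≤ 3 κ₁ ≤ κ`.
  set κ₁ := min 1 (κ / 3) with hκ₁
  have hκ₁0 : 0 < κ₁ := by positivity
  obtain ⟨s₀, hs₀, H⟩ := exists_isPoissonBump_exp (star_poissonOp (d := d) (n := n)) hκ₁0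
  have hN : {Q : Matrix (Fin d ⊕ Fin d) (Fin d ⊕ Fin d) ℝ |
      ‖blockOp d n (Q, 1) - 1‖ ≤ 1 / 2} ∈ 𝓝 1 := by
    have hc : Continuous fun Q : Matrix (Fin d ⊕ Fin d) (Fin d ⊕ Fin d) ℝ =>
        ‖blockOp d n (Q, 1) - 1‖ :=
      ((continuous_blockOp.comp (by fun_prop)).sub continuous_const).norm
    refine hc.tendsto 1 (Iic_mem_nhds ?_)
    rw [← Prod.one_eq_mk, map_one, sub_self, norm_zero]
    norm_num
  obtain ⟨η, hη, hη0, hηs⟩ := ((eventually_exists_exp_smul_J_mul _ hN).and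
    (Ioc_mem_nhdsGT hs₀)).exists
  obtain ⟨δ, hδ, hδA⟩ := exists_colSumNorm_lt_imp_mem hη
  refine ⟨δ, hδ, fun A hA hAδ r hr => ?_⟩
  obtain ⟨Q, hQN, hQt, hQ⟩ := hδA A hAδ hA
  obtain ⟨h₁, hh₁, hd₁⟩ := H (-η) r 1 (by rw [abs_neg, abs_of_pos hη0]; exact hηs) hr
    (IsSelfAdjoint.one _) (by simp)
  -- The identity block in the `z` directions keeps the quadratic form definite on the whole space,
  -- so the support is bounded there too. Since `P` vanishes on that block, the derivative at the
  -- origin is still the identity in `z`.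
  obtain ⟨h₂, hh₂, hd₂⟩ := H η r (blockOp d n (Q, 1)) (by rw [abs_of_pos hη0]; exact hηs) hr
    (by rw [IsSelfAdjoint, blockOp_transpose, hQt, transpose_one]) hQN
  have hexp : exp (η • J (Fin d) ℝ) * exp (-(η • J (Fin d) ℝ)) = 1 := by
    have := exp_neg_mul_exp (-(η • J (Fin d) ℝ))
    rw [neg_neg] at this
    exact this
  refine ⟨h₁.trans h₂, ?_, ?_⟩
  · have hb := hh₁.trans hh₂
    refine { hb with norm_fderiv_sub_le := fun w => (hb.norm_fderiv_sub_le w).trans ?_ }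
    have h1 : κ₁ ≤ 1 := min_le_left _ _
    have h2 : κ₁ ≤ κ / 3 := min_le_right _ _
    nlinarith
  · rw [hh₁.fderiv_trans hh₂, hh₁.map_zero, hd₁, hd₂, mul_one, poissonOp, ← map_mul,
      Prod.mk_mul_mk, zero_mul, ← blockOp_smul, ← blockOp_smul, Prod.smul_mk, Prod.smul_mk,
      smul_zero, smul_zero, exp_blockOp, exp_blockOp, ← map_mul, Prod.mk_mul_mk, one_mul, hQ,
      neg_smul, mul_assoc, hexp, mul_one]
    rfl

end Coordinates

/-! ### Extending a compactly supported map of a chart by the identity -/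

section ChartExtension

open Filter

variable {E : Type*} [NormedAddCommGroup E] {M : Type*} [TopologicalSpace M]

open Classical in
/-- The map of `M` equal to `k` in the chart `ψ`, and to the identity off its domain. -/
def chartExtend (ψ : OpenPartialHomeomorph M E) (k : E → E) (x : M) : M :=
  if x ∈ ψ.source then ψ.symm (k (ψ x)) else x

/-- The bijection `k` of `E` is the identity outside the subset `C` of the image of `ψ`. -/
structure SupportedIn (ψ : OpenPartialHomeomorph M E) (k : E ≃ E) (C : Set E) : Prop where
  isCompact : IsCompact C
  subset_target : C ⊆ ψ.target
  eq_self : ∀ u ∉ C, k u = u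

variable {ψ : OpenPartialHomeomorph M E} {k : E ≃ E} {C : Set E}

theorem chartExtend_of_mem {k : E → E} {x : M} (hx : x ∈ ψ.source) :
    chartExtend ψ k x = ψ.symm (k (ψ x)) := by
  rw [chartExtend, if_pos hx]

theorem eventually_apply_symm_mem {a : OpenPartialHomeomorph M E} {f : M → M} {x : M}
    (hf : ContinuousAt f x) (hx : x ∈ a.source) {U : Set M} (hU : IsOpen U) (hfx : f x ∈ U) :
    ∀ᶠ u in 𝓝 (a x), f (a.symm u) ∈ U := by
  have h1 : Tendsto (fun u => f (a.symm u)) (𝓝 (a x)) (𝓝 (f x)) :=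
    hf.tendsto.comp (by simpa [a.left_inv hx] using a.tendsto_symm hx)
  exact h1.eventually (hU.mem_nhds hfx)

namespace SupportedIn

theorem symm (h : SupportedIn ψ k C) : SupportedIn ψ k.symm C :=
  ⟨h.isCompact, h.subset_target, fun u hu => by rw [Equiv.symm_apply_eq, h.eq_self u hu]⟩

theorem apply_mem (h : SupportedIn ψ k C) {u : E} (hu : u ∈ C) : k u ∈ C := by
  by_contra hc
  exact hc (by rwa [k.injective (h.eq_self _ hc)])

theorem apply_mem_target (h : SupportedIn ψ k C) {u : E} (hu : u ∈ ψ.target) :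
    k u ∈ ψ.target := by
  by_cases hC : u ∈ C
  · exact h.subset_target (h.apply_mem hC)
  · rwa [h.eq_self u hC]

theorem chartExtend_mem_source (h : SupportedIn ψ k C) {x : M} (hx : x ∈ ψ.source) :
    chartExtend ψ k x ∈ ψ.source := by
  rw [chartExtend_of_mem hx]
  exact ψ.map_target (h.apply_mem_target (ψ.map_source hx))

theorem apply_chartExtend (h : SupportedIn ψ k C) {x : M} (hx : x ∈ ψ.source) :
    ψ (chartExtend ψ k x) = k (ψ x) := by
  rw [chartExtend_of_mem hx, ψ.right_inv (h.apply_mem_target (ψ.map_source hx))]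

theorem chartExtend_symm_chartExtend (h : SupportedIn ψ k C) (x : M) :
    chartExtend ψ k.symm (chartExtend ψ k x) = x := by
  by_cases hx : x ∈ ψ.source
  · rw [chartExtend_of_mem (h.chartExtend_mem_source hx), h.apply_chartExtend hx,
      Equiv.symm_apply_apply, ψ.left_inv hx]
  · simp [chartExtend, hx]

theorem isClosed_image [T2Space M] (h : SupportedIn ψ k C) : IsClosed (ψ.symm '' C) :=
  (h.isCompact.image_of_continuousOn (ψ.continuousOn_symm.mono h.subset_target)).isClosed

theorem chartExtend_eq_self (h : SupportedIn ψ k C) {x : M} (hx : x ∉ ψ.symm '' C) :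
    chartExtend ψ k x = x := by
  by_cases hs : x ∈ ψ.source
  · rw [chartExtend_of_mem hs, h.eq_self, ψ.left_inv hs]
    exact fun hC => hx ⟨_, hC, ψ.left_inv hs⟩
  · simp [chartExtend, hs]

theorem inCharts_comp_chartExtend_eventuallyEq (h : SupportedIn ψ k C)
    {a : OpenPartialHomeomorph M E} {f : M → M} (hf : Continuous f) {x : M}
    (hx : x ∈ a.source) (hfx : f x ∈ ψ.source) :
    inCharts a ψ (fun x => chartExtend ψ k (f x)) =ᶠ[𝓝 (a x)] k ∘ inCharts a ψ f := by
  filter_upwards [eventually_apply_symm_mem hf.continuousAt hx ψ.open_source hfx]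
    with u hu using h.apply_chartExtend hu

variable [NormedSpace ℝ E] [ChartedSpace E M] [T2Space M]

/-- Off the domain of `ψ` the map is the identity on a whole neighborhood, because the compact image
of `C` is closed in the Hausdorff space `M`. -/
theorem contMDiff_chartExtend [IsManifold 𝓘(ℝ, E) ∞ M] (h : SupportedIn ψ k C)
    (hψ : ψ ∈ IsManifold.maximalAtlas 𝓘(ℝ, E) ∞ M) (hk : ContDiff ℝ ∞ k) :
    ContMDiff 𝓘(ℝ, E) 𝓘(ℝ, E) ∞ (chartExtend ψ k) := by
  intro x
  by_cases hx : x ∈ ψ.source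
  · have h1 : chartExtend ψ k =ᶠ[𝓝 x] fun x => ψ.symm (k (ψ x)) := by
      filter_upwards [ψ.open_source.mem_nhds hx] with y hy using chartExtend_of_mem hy
    refine ContMDiffAt.congr_of_eventuallyEq ?_ h1
    have h2 : ContMDiffAt 𝓘(ℝ, E) 𝓘(ℝ, E) ∞ ψ.symm (k (ψ x)) :=
      (contMDiffOn_symm_of_mem_maximalAtlas hψ).contMDiffAt
        (ψ.open_target.mem_nhds (h.apply_mem_target (ψ.map_source hx)))
    exact h2.comp x (hk.contMDiff.contMDiffAt.comp x (contMDiffAt_of_mem_maximalAtlas hψ hx))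
  · have hx' : x ∈ (ψ.symm '' C)ᶜ := by
      rintro ⟨u, hu, rfl⟩
      exact hx (ψ.map_target (h.subset_target hu))
    have h1 : chartExtend ψ k =ᶠ[𝓝 x] id := by
      filter_upwards [h.isClosed_image.isOpen_compl.mem_nhds hx'] with y hy
        using h.chartExtend_eq_self hy
    exact contMDiffAt_id.congr_of_eventuallyEq h1

/-- `chartExtend` as a diffeomorphism. -/
def diffeomorph [IsManifold 𝓘(ℝ, E) ∞ M] (h : SupportedIn ψ k C)
    (hψ : ψ ∈ IsManifold.maximalAtlas 𝓘(ℝ, E) ∞ M) (hk : ContDiff ℝ ∞ k)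
    (hk' : ContDiff ℝ ∞ k.symm) : M ≃ₘ^1⟮𝓘(ℝ, E), 𝓘(ℝ, E)⟯ M where
  toFun := chartExtend ψ k
  invFun := chartExtend ψ k.symm
  left_inv := h.chartExtend_symm_chartExtend
  right_inv x := by simpa using h.symm.chartExtend_symm_chartExtend x
  contMDiff_toFun := (h.contMDiff_chartExtend hψ hk).of_le (by simp)
  contMDiff_invFun := (h.symm.contMDiff_chartExtend hψ hk').of_le (by simp)

end SupportedIn

end ChartExtension

/-! ### The extended map is Poisson -/

section PoissonExtension

open Filter

theorem IsPoissonDiffeo.trans {E : Type*} [NormedAddCommGroup E] [NormedSpace ℝ E] {M : Type*}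
    [TopologicalSpace M] [ChartedSpace E M] {π : PoissonStructure E M}
    {f g : M ≃ₘ^1⟮𝓘(ℝ, E), 𝓘(ℝ, E)⟯ M} (hf : IsPoissonDiffeo π f) (hg : IsPoissonDiffeo π g) :
    IsPoissonDiffeo π (f.trans g) := by
  intro x ξ η
  have h1 : mfderiv 𝓘(ℝ, E) 𝓘(ℝ, E) (f.trans g) x =
      (mfderiv 𝓘(ℝ, E) 𝓘(ℝ, E) g (f x)).comp (mfderiv 𝓘(ℝ, E) 𝓘(ℝ, E) f x) :=
    mfderiv_comp x ((g.contMDiff _).mdifferentiableAt (by simp))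
      ((f.contMDiff _).mdifferentiableAt (by simp))
  rw [h1]
  exact (hg (f x) ξ η).trans (hf x _ _)

/-- If `T`, `T'` carry `B`, `B'` to `c`, and `D` corresponds to `K`, which preserves `c`, then `D`
carries `B'` to `B`. -/
theorem bilinear_comp_eq_of_intertwining {E : Type*} [NormedAddCommGroup E] [NormedSpace ℝ E]
    {B B' c : (E →L[ℝ] ℝ) → (E →L[ℝ] ℝ) → ℝ} {S T T' D K : E →L[ℝ] E}
    (hS : S.comp T = ContinuousLinearMap.id ℝ E) (hD : T.comp D = K.comp T')
    (hB : ∀ ξ η, B (ξ.comp T) (η.comp T) = c ξ η)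
    (hB' : ∀ ξ η, B' (ξ.comp T') (η.comp T') = c ξ η)
    (hK : ∀ ξ η, c (ξ.comp K) (η.comp K) = c ξ η) (ξ η : E →L[ℝ] ℝ) :
    B ξ η = B' (ξ.comp D) (η.comp D) := by
  have h1 : ∀ ξ : E →L[ℝ] ℝ, (ξ.comp S).comp T = ξ := fun ξ => by
    rw [ContinuousLinearMap.comp_assoc, hS, ContinuousLinearMap.comp_id]
  have h2 : ∀ ξ : E →L[ℝ] ℝ, ξ.comp D = ((ξ.comp S).comp K).comp T' := fun ξ => by
    conv_lhs => rw [← h1 ξ]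
    rw [ContinuousLinearMap.comp_assoc, hD, ContinuousLinearMap.comp_assoc _ K]
  rw [h2, h2, hB', hK, ← hB, h1, h1]

variable {d n : ℕ} {M : Type*} [TopologicalSpace M] [T2Space M]
  [ChartedSpace (PSpace d n) M] [IsManifold 𝓘(ℝ, PSpace d n) ∞ M]
  {π : PoissonStructure (PSpace d n) M} {ψ : OpenPartialHomeomorph M (PSpace d n)}
  {k : PSpace d n ≃ PSpace d n} {C : Set (PSpace d n)}

theorem IsDarbouxChart.isPoissonDiffeo_diffeomorph (hψ : IsDarbouxChart π ψ)
    (h : SupportedIn ψ k C) (hk : ContDiff ℝ ∞ k) (hk' : ContDiff ℝ ∞ k.symm)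
    (hP : ∀ (u) (ξ η : PSpace d n →L[ℝ] ℝ), canonicalBivector (ξ.comp (fderiv ℝ k u))
      (η.comp (fderiv ℝ k u)) = canonicalBivector ξ η) :
    IsPoissonDiffeo π (h.diffeomorph hψ.1 hk hk') := by
  set H := h.diffeomorph hψ.1 hk hk'
  intro x ξ η
  have hHd : MDifferentiableAt 𝓘(ℝ, PSpace d n) 𝓘(ℝ, PSpace d n) H x :=
    (H.contMDiff _).mdifferentiableAt (by simp)
  by_cases hx : x ∈ ψ.source
  · have hHx : H x ∈ ψ.source := h.chartExtend_mem_source hx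
    have hψd : ∀ y ∈ ψ.source, MDifferentiableAt 𝓘(ℝ, PSpace d n) 𝓘(ℝ, PSpace d n) ψ y :=
      fun y hy => (contMDiffAt_of_mem_maximalAtlas hψ.1 hy).mdifferentiableAt (by simp)
    have hψs : MDifferentiableAt 𝓘(ℝ, PSpace d n) 𝓘(ℝ, PSpace d n) ψ.symm (ψ (H x)) :=
      (contMDiffAt_symm_of_mem_maximalAtlas hψ.1 (ψ.map_source hHx)).mdifferentiableAt (by simp)
    set S := mfderiv 𝓘(ℝ, PSpace d n) 𝓘(ℝ, PSpace d n) ψ.symm (ψ (H x))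
    have hinv : S.comp (mfderiv 𝓘(ℝ, PSpace d n) 𝓘(ℝ, PSpace d n) ψ (H x)) =
        ContinuousLinearMap.id ℝ (PSpace d n) := by
      have h1 := mfderiv_comp (H x) hψs (hψd _ hHx)
      have h2 : ψ.symm ∘ ψ =ᶠ[𝓝 (H x)] id := by
        filter_upwards [ψ.open_source.mem_nhds hHx] with y hy using ψ.left_inv hy
      rw [h2.mfderiv_eq, mfderiv_id] at h1
      exact h1.symm
    have hchain : (mfderiv 𝓘(ℝ, PSpace d n) 𝓘(ℝ, PSpace d n) ψ (H x)).comp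
        (mfderiv 𝓘(ℝ, PSpace d n) 𝓘(ℝ, PSpace d n) H x) =
        (fderiv ℝ k (ψ x)).comp (mfderiv 𝓘(ℝ, PSpace d n) 𝓘(ℝ, PSpace d n) ψ x) := by
      have h1 := mfderiv_comp x (hψd _ hHx) hHd
      have h2 : ψ ∘ H =ᶠ[𝓝 x] k ∘ ψ := by
        filter_upwards [ψ.open_source.mem_nhds hx] with y hy using h.apply_chartExtend hy
      have h3 := mfderiv_comp x (hk.contMDiff.mdifferentiableAt (x := ψ x) (by simp)) (hψd _ hx)
      rw [h2.mfderiv_eq, h3, mfderiv_eq_fderiv] at h1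
      exact h1.symm
    exact bilinear_comp_eq_of_intertwining (B := fun ξ η => π.bivector (H x) ξ η)
      (B' := fun ξ η => π.bivector x ξ η) hinv hchain (hψ.2 (H x) hHx) (hψ.2 x hx) (hP _) ξ η
  · have hx' : x ∈ (ψ.symm '' C)ᶜ := by
      rintro ⟨u, hu, rfl⟩
      exact hx (ψ.map_target (h.subset_target hu))
    have h1 : H =ᶠ[𝓝 x] id := by
      filter_upwards [h.isClosed_image.isOpen_compl.mem_nhds hx'] with y hy
        using h.chartExtend_eq_self hy
    have h2 : H x = x := h1.eq_of_nhds
    have h3 : mfderiv 𝓘(ℝ, PSpace d n) 𝓘(ℝ, PSpace d n) H x =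
        ContinuousLinearMap.id ℝ (PSpace d n) := by
      rw [h1.mfderiv_eq, mfderiv_id]
      rfl
    -- The forms at `H x` and at `x` have different dependent types. Covectors on the model space
    -- serve both, so the equality of base points can be substituted.
    have h4 : ∀ y, y = x → ∀ ξ η : PSpace d n →L[ℝ] ℝ,
        π.bivector y ξ η = π.bivector x ξ η := by
      rintro y rfl ξ η
      rfl
    refine (h4 _ h2 ξ η).trans ?_
    rw [h3]
    rfl

end PoissonExtension

/-! ### Derivative estimates in arbitrary charts -/

section LocalExpressions

open Filter

variable {E : Type*} [NormedAddCommGroup E] [NormedSpace ℝ E]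
  {M : Type*} [TopologicalSpace M] [ChartedSpace E M]

theorem contDiffAt_inCharts [IsManifold 𝓘(ℝ, E) ∞ M] {a b : OpenPartialHomeomorph M E}
    (ha : a ∈ IsManifold.maximalAtlas 𝓘(ℝ, E) ∞ M)
    (hb : b ∈ IsManifold.maximalAtlas 𝓘(ℝ, E) ∞ M) {f : M → M}
    (hf : ContMDiff 𝓘(ℝ, E) 𝓘(ℝ, E) 1 f) {u : E} (hu : u ∈ a.target)
    (hfu : f (a.symm u) ∈ b.source) : ContDiffAt ℝ 1 (inCharts a b f) u := by
  rw [← contMDiffAt_iff_contDiffAt]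
  exact ((contMDiffAt_of_mem_maximalAtlas hb hfu).of_le (by simp)).comp u
    (hf.contMDiffAt.comp u ((contMDiffAt_symm_of_mem_maximalAtlas ha hu).of_le (by simp)))

variable {a b ψ : OpenPartialHomeomorph M E} {f : M → M} {k : E ≃ E} {C : Set E}

/-- Values and derivatives of the local expressions of `f` and of its perturbation, in terms of
the transition map `b ∘ ψ⁻¹`. -/
theorem norm_fderiv_inCharts_chartExtend_sub_le [IsManifold 𝓘(ℝ, E) ∞ M]
    (ha : a ∈ IsManifold.maximalAtlas 𝓘(ℝ, E) ∞ M)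
    (hb : b ∈ IsManifold.maximalAtlas 𝓘(ℝ, E) ∞ M)
    (hψ : ψ ∈ IsManifold.maximalAtlas 𝓘(ℝ, E) ∞ M) (h : SupportedIn ψ k C)
    (hf : ContMDiff 𝓘(ℝ, E) 𝓘(ℝ, E) 1 f) (hk : Differentiable ℝ k) {κ : ℝ}
    (hκ : ∀ u, ‖fderiv ℝ k u - 1‖ ≤ κ) {x : M} (hx : x ∈ a.source) (hfx : f x ∈ ψ.source)
    (hfb : f x ∈ b.source) (hgb : chartExtend ψ k (f x) ∈ b.source) :
    ‖fderiv ℝ (inCharts a b (fun x => chartExtend ψ k (f x))) (a x) -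
        fderiv ℝ (inCharts a b f) (a x)‖ ≤
      (‖fderiv ℝ (inCharts ψ b id) (k (ψ (f x)))‖ * κ +
        ‖fderiv ℝ (inCharts ψ b id) (k (ψ (f x))) - fderiv ℝ (inCharts ψ b id) (ψ (f x))‖) *
        ‖fderiv ℝ (inCharts a ψ f) (a x)‖ := by
  have hax : inCharts a ψ f (a x) = ψ (f x) := by rw [inCharts, a.left_inv hx]
  have hev : ∀ᶠ u in 𝓝 (a x), f (a.symm u) ∈ ψ.source :=
    eventually_apply_symm_mem hf.continuous.continuousAt hx ψ.open_source hfx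
  have e1 : inCharts a b f =ᶠ[𝓝 (a x)] inCharts ψ b id ∘ inCharts a ψ f := by
    filter_upwards [hev] with u hu
    simp [inCharts, ψ.left_inv hu]
  have e2 : inCharts a b (fun x => chartExtend ψ k (f x)) =ᶠ[𝓝 (a x)]
      inCharts ψ b id ∘ (k ∘ inCharts a ψ f) := by
    filter_upwards [hev] with u hu
    simp [inCharts, chartExtend_of_mem hu]
  have dF : DifferentiableAt ℝ (inCharts a ψ f) (a x) :=
    (contDiffAt_inCharts ha hψ hf (a.map_source hx) (by rwa [a.left_inv hx])).differentiableAt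
      (by simp)
  have dτ : DifferentiableAt ℝ (inCharts ψ b id) (ψ (f x)) :=
    (contDiffAt_inCharts hψ hb contMDiff_id (ψ.map_source hfx)
      (by rwa [ψ.left_inv hfx])).differentiableAt (by simp)
  have dτ' : DifferentiableAt ℝ (inCharts ψ b id) (k (ψ (f x))) :=
    (contDiffAt_inCharts hψ hb contMDiff_id (h.apply_mem_target (ψ.map_source hfx))
      (by rwa [← chartExtend_of_mem hfx])).differentiableAt (by simp)
  have f1 : fderiv ℝ (inCharts a b f) (a x) =
      (fderiv ℝ (inCharts ψ b id) (ψ (f x))).comp (fderiv ℝ (inCharts a ψ f) (a x)) := by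
    rw [e1.fderiv_eq, fderiv_comp _ (by rwa [hax]) dF, hax]
  have f2 : fderiv ℝ (inCharts a b (fun x => chartExtend ψ k (f x))) (a x) =
      (fderiv ℝ (inCharts ψ b id) (k (ψ (f x)))).comp
        ((fderiv ℝ k (ψ (f x))).comp (fderiv ℝ (inCharts a ψ f) (a x))) := by
    rw [e2.fderiv_eq, fderiv_comp _ (by rwa [Function.comp_apply, hax])
      (hk.differentiableAt.comp _ dF), fderiv_comp _ hk.differentiableAt dF, Function.comp_apply,
      hax]
  -- With `τ` the derivative of `b ∘ ψ⁻¹` at the original point and `τ'` at the displaced one, this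
  -- is `τ' k' - τ = τ' (k' - 1) + (τ' - τ)`, composed with the derivative of `f`. The first term is
  -- controlled by `κ`, the second by continuity.
  have f3 : fderiv ℝ (inCharts a b (fun x => chartExtend ψ k (f x))) (a x) -
        fderiv ℝ (inCharts a b f) (a x) =
      ((fderiv ℝ (inCharts ψ b id) (k (ψ (f x)))).comp (fderiv ℝ k (ψ (f x)) - 1) +
        (fderiv ℝ (inCharts ψ b id) (k (ψ (f x))) -
          fderiv ℝ (inCharts ψ b id) (ψ (f x)))).comp (fderiv ℝ (inCharts a ψ f) (a x)) := by
    rw [f1, f2]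
    ext v
    simp
  rw [f3]
  refine (ContinuousLinearMap.opNorm_comp_le _ _).trans ?_
  gcongr
  refine (norm_add_le _ _).trans ?_
  gcongr
  refine (ContinuousLinearMap.opNorm_comp_le _ _).trans ?_
  gcongr
  exact hκ _

end LocalExpressions

/-! ### Choice of constants and the main theorem -/

section Main

open Filter

theorem exists_pos_forall_mem_mul_lt {ι : Type*} {s : Set ι} (hs : s.Finite) (α β : ι → ℝ)
    {ε : ℝ} (hε : 0 < ε) : ∃ κ : ℝ, 0 < κ ∧ ∀ i ∈ s, α i * κ * β i < ε := by
  have h : ∀ᶠ κ : ℝ in 𝓝[>] 0, ∀ i ∈ s, α i * κ * β i < ε := by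
    rw [hs.eventually_all]
    intro i _
    have hc : Continuous fun κ : ℝ => α i * κ * β i := by fun_prop
    exact nhdsWithin_le_nhds (hc.tendsto 0 (Iio_mem_nhds (by simpa using hε)))
  obtain ⟨κ, h1, h2⟩ := (h.and self_mem_nhdsWithin).exists
  exact ⟨κ, h2, h1⟩

/-- The conjugate of `h` by the translation by `u₀`. -/
def translateEquiv {E : Type*} [AddCommGroup E] (u₀ : E) (h : E ≃ E) : E ≃ E :=
  ((Equiv.subRight u₀).trans h).trans (Equiv.addRight u₀)

section Local

variable {E : Type*} [NormedAddCommGroup E] [NormedSpace ℝ E]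
  {M : Type*} [TopologicalSpace M] [ChartedSpace E M] [IsManifold 𝓘(ℝ, E) ∞ M]
  {a b ψ : OpenPartialHomeomorph M E} {f : M → M} {p : M}

/-- Near `p`, and for a displaced point `z` near `ψ (f p)`, the quantities that bound the
`C¹`-distance of a perturbation of `f` in the charts `a`, `b` are small. -/
theorem eventually_perturbation_small
    (ha : a ∈ IsManifold.maximalAtlas 𝓘(ℝ, E) ∞ M)
    (hb : b ∈ IsManifold.maximalAtlas 𝓘(ℝ, E) ∞ M)
    (hψ : ψ ∈ IsManifold.maximalAtlas 𝓘(ℝ, E) ∞ M)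
    (hf : ContMDiff 𝓘(ℝ, E) 𝓘(ℝ, E) 1 f) (hpa : p ∈ a.source) (hpb : f p ∈ b.source)
    (hpψ : f p ∈ ψ.source) {κ ε : ℝ} (hε : 0 < ε)
    (hκ : ‖fderiv ℝ (inCharts ψ b id) (ψ (f p))‖ * κ *
      ‖fderiv ℝ (inCharts a ψ f) (a p)‖ < ε) :
    ∀ᶠ q : E × M in 𝓝 (ψ (f p)) ×ˢ 𝓝 p,
      ψ.symm q.1 ∈ b.source ∧ f q.2 ∈ b.source ∧ q.2 ∈ a.source ∧
      ‖inCharts ψ b id q.1 - b (f q.2)‖ < ε ∧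
      (‖fderiv ℝ (inCharts ψ b id) q.1‖ * κ +
        ‖fderiv ℝ (inCharts ψ b id) q.1 - fderiv ℝ (inCharts ψ b id) (ψ (f q.2))‖) *
        ‖fderiv ℝ (inCharts a ψ f) (a q.2)‖ < ε := by
  have cτ : ContDiffAt ℝ 1 (inCharts ψ b id) (ψ (f p)) :=
    contDiffAt_inCharts hψ hb contMDiff_id (ψ.map_source hpψ) (by rwa [ψ.left_inv hpψ])
  have cF : ContDiffAt ℝ 1 (inCharts a ψ f) (a p) :=
    contDiffAt_inCharts ha hψ hf (a.map_source hpa) (by rwa [a.left_inv hpa])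
  have t1 : Tendsto (fun q : E × M => q.1) (𝓝 (ψ (f p)) ×ˢ 𝓝 p) (𝓝 (ψ (f p))) := tendsto_fst
  have t2 : Tendsto (fun q : E × M => q.2) (𝓝 (ψ (f p)) ×ˢ 𝓝 p) (𝓝 p) := tendsto_snd
  have t3 : Tendsto (fun q : E × M => f q.2) (𝓝 (ψ (f p)) ×ˢ 𝓝 p) (𝓝 (f p)) :=
    (hf.continuous.tendsto p).comp t2
  have t4 : Tendsto (fun q : E × M => ψ (f q.2)) (𝓝 (ψ (f p)) ×ˢ 𝓝 p) (𝓝 (ψ (f p))) :=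
    (ψ.continuousAt hpψ).tendsto.comp t3
  have t5 : Tendsto (fun q : E × M => a q.2) (𝓝 (ψ (f p)) ×ˢ 𝓝 p) (𝓝 (a p)) :=
    (a.continuousAt hpa).tendsto.comp t2
  have d1 : ContinuousAt (fderiv ℝ (inCharts ψ b id)) (ψ (f p)) :=
    (cτ.fderiv_right (m := 0) (by simp)).continuousAt
  have d2 : ContinuousAt (fderiv ℝ (inCharts a ψ f)) (a p) :=
    (cF.fderiv_right (m := 0) (by simp)).continuousAt
  have s1 := d1.tendsto.comp t1
  have s2 := d1.tendsto.comp t4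
  have s3 := d2.tendsto.comp t5
  have e1 := t1.eventually ((ψ.tendsto_symm hpψ).eventually (b.open_source.mem_nhds hpb))
  have e2 := t3.eventually (b.open_source.mem_nhds hpb)
  have e3 := t2.eventually (a.open_source.mem_nhds hpa)
  have v : inCharts ψ b id (ψ (f p)) = b (f p) := by simp [inCharts, ψ.left_inv hpψ]
  have s4 := ((cτ.continuousAt.tendsto.comp t1).sub
    ((b.continuousAt hpb).tendsto.comp t3)).norm
  rw [v, sub_self, norm_zero] at s4
  -- In the limit the two transition derivatives agree, so only the quantity bounded in `hκ`
  -- survives.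
  have s5 := ((s1.norm.mul_const κ).add (s1.sub s2).norm).mul s3.norm
  rw [sub_self, norm_zero, add_zero] at s5
  filter_upwards [e1, e2, e3, s4.eventually (Iio_mem_nhds hε), s5.eventually (Iio_mem_nhds hκ)]
    with q h1 h2 h3 h4 h5
  exact ⟨h1, h2, h3, h4, h5⟩

end Local

variable {d n : ℕ}

theorem supportedIn_translateEquiv {M : Type*} [TopologicalSpace M]
    {ψ : OpenPartialHomeomorph M (PSpace d n)} {P : PSpace d n →L[ℝ] PSpace d n} {r κ : ℝ}
    {h : PSpace d n ≃ PSpace d n} (hh : IsPoissonBump P r κ h) {u₀ : PSpace d n}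
    (hr : Metric.closedBall u₀ r ⊆ ψ.target) :
    SupportedIn ψ (translateEquiv u₀ h) (Metric.closedBall u₀ r) := by
  refine ⟨isCompact_closedBall _ _, hr, fun u hu => ?_⟩
  rw [Metric.mem_closedBall, not_le, dist_eq_norm] at hu
  simp [translateEquiv, hh.eq_self _ hu.le]

theorem fderiv_translateEquiv {E : Type*} [NormedAddCommGroup E] [NormedSpace ℝ E] (u₀ : E)
    (h : E ≃ E) (u : E) : fderiv ℝ (translateEquiv u₀ h) u = fderiv ℝ h (u - u₀) := by
  change fderiv ℝ (fun u => h (u - u₀) + u₀) u = _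
  rw [fderiv_add_const, fderiv_comp_sub]

theorem contDiff_translateEquiv {E : Type*} [NormedAddCommGroup E] [NormedSpace ℝ E] (u₀ : E)
    {h : E ≃ E} (hh : ContDiff ℝ ∞ h) : ContDiff ℝ ∞ (translateEquiv u₀ h) :=
  (hh.comp (contDiff_id.sub contDiff_const)).add contDiff_const

theorem contDiff_translateEquiv_symm {E : Type*} [NormedAddCommGroup E] [NormedSpace ℝ E] (u₀ : E)
    {h : E ≃ E} (hh : ContDiff ℝ ∞ h.symm) : ContDiff ℝ ∞ (translateEquiv u₀ h).symm := by
  have h1 : ⇑(translateEquiv u₀ h).symm = fun u => h.symm (u - u₀) + u₀ := by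
    ext u
    simp [translateEquiv, sub_eq_add_neg]
  rw [h1]
  exact (hh.comp (contDiff_id.sub contDiff_const)).add contDiff_const

theorem theorem1 (d n : ℕ) {M : Type*} [TopologicalSpace M] [T2Space M]
    [SecondCountableTopology M] [ChartedSpace (PSpace d n) M]
    [IsManifold 𝓘(ℝ, PSpace d n) ∞ M]
    (π : PoissonStructure (PSpace d n) M) (hπ : π.IsRegularOfRank d)
    (f : M ≃ₘ^1⟮𝓘(ℝ, PSpace d n), 𝓘(ℝ, PSpace d n)⟯ M) (hf : IsPoissonDiffeo π f)
    (p : M)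
    (φ ψ : OpenPartialHomeomorph M (PSpace d n))
    (hφ : IsDarbouxChart π φ) (hpφ : p ∈ φ.source)
    (hψ : IsDarbouxChart π ψ) (hpψ : f p ∈ ψ.source)
    {ι : Type*} (𝒜 : C1Charts (PSpace d n) f ι) (ε : ℝ) (hε : 0 < ε) :
    ∃ δ : ℝ, 0 < δ ∧ ∀ V ∈ 𝓝 p,
      {B | ∃ A ∈ Matrix.symplecticGroup (Fin d) ℝ, colSumNorm (A - 1) < δ ∧
          B = poissonExtension n A * derivMatrix φ ψ f p} ⊆
        {B | ∃ g ∈ poissonBall π 𝒜 ε (Vᶜ ∪ {p}), B = derivMatrix φ ψ g p} := by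
  -- Strict bounds at each point give only a weak bound for the supremum; working with `ε / 2`
  -- restores strictness.
  have hε2 : 0 < ε / 2 := by positivity
  have hfin : {i | p ∈ 𝒜.K i}.Finite := 𝒜.locallyFinite.point_finite p
  obtain ⟨κ, hκ0, hκ⟩ := exists_pos_forall_mem_mul_lt hfin
    (fun i => ‖fderiv ℝ (inCharts ψ (𝒜.cod i) id) (ψ (f p))‖)
    (fun i => ‖fderiv ℝ (inCharts (𝒜.dom i) ψ f) (𝒜.dom i p)‖) hε2
  obtain ⟨δ, hδ, hbump⟩ := exists_isPoissonBump_poissonExtension d n hκ0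
  refine ⟨δ, hδ, ?_⟩
  rintro V hV B ⟨A, hA, hAδ, rfl⟩
  -- The displaced point is a free variable here, because the bump is available only after the
  -- radius `r` has been fixed from these neighborhoods.
  have hsmall := (hfin.eventually_all).2 fun i hi =>
    eventually_perturbation_small (𝒜.dom_mem i) (𝒜.cod_mem i) hψ.1 f.contMDiff
      (𝒜.subset_dom i hi) (𝒜.mapsTo_cod i hi) hpψ hε2 (hκ i hi)
  obtain ⟨Z, hZ, N, hN, hZN⟩ := Filter.mem_prod_iff.1 hsmall
  -- Points near `p` lie only in those `K i` that contain `p`, so the finitely many indices used to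
  -- choose `κ` suffice.
  have hK := 𝒜.locallyFinite.eventually_subset (fun i => (𝒜.isCompact i).isClosed) p
  have hpull : Tendsto (fun u => f.symm (ψ.symm u)) (𝓝 (ψ (f p))) (𝓝 p) := by
    have := (f.symm.continuous.tendsto (f p)).comp (ψ.tendsto_symm hpψ)
    rwa [f.symm_apply_apply] at this
  obtain ⟨r, hr, hrsub⟩ := Metric.nhds_basis_closedBall.mem_iff.1
    (inter_mem (inter_mem (ψ.open_target.mem_nhds (ψ.map_source hpψ)) hZ)
      (hpull (inter_mem (inter_mem hV hN) hK)))
  obtain ⟨h, hh, hhA⟩ := hbump A hA hAδ r hr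
  set u₀ := ψ (f p) with hu₀
  have hsupp : SupportedIn ψ (translateEquiv u₀ h) (Metric.closedBall u₀ r) :=
    supportedIn_translateEquiv hh fun u hu => (hrsub hu).1.1
  set k := translateEquiv u₀ h with hk
  have hk1 : ContDiff ℝ ∞ k := contDiff_translateEquiv u₀ hh.contDiff
  have hk2 : ContDiff ℝ ∞ k.symm := contDiff_translateEquiv_symm u₀ hh.contDiff_symm
  have hkd : Differentiable ℝ k := hk1.differentiable (by simp)
  have hku₀ : k u₀ = u₀ := by simp [hk, translateEquiv, hh.map_zero]
  have hkκ : ∀ u, ‖fderiv ℝ k u - 1‖ ≤ κ := fun u => by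
    rw [hk, fderiv_translateEquiv]
    exact hh.norm_fderiv_sub_le _
  set S := ψ.symm '' Metric.closedBall u₀ r with hS
  -- points whose image lies in the support
  have hmem : ∀ x, f x ∈ S → f x ∈ ψ.source ∧ k (ψ (f x)) ∈ Z ∧ x ∈ V ∧ x ∈ N ∧
      ∀ i, x ∈ 𝒜.K i → p ∈ 𝒜.K i := by
    rintro x ⟨u, hu, hux⟩
    have hu' := hrsub hu
    have hfs : f.symm (ψ.symm u) = x := by rw [hux, f.symm_apply_apply]
    have hψu : ψ (f x) = u := by rw [← hux, ψ.right_inv hu'.1.1]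
    have h3 := hu'.2
    rw [mem_preimage, hfs] at h3
    refine ⟨hux ▸ ψ.map_target hu'.1.1, ?_, h3.1.1, h3.1.2, fun i hi => h3.2 hi⟩
    rw [hψu]
    exact (hrsub (hsupp.apply_mem hu)).1.2
  set H := hsupp.diffeomorph hψ.1 hk1 hk2 with hH
  have hHP : IsPoissonDiffeo π H := hψ.isPoissonDiffeo_diffeomorph hsupp hk1 hk2 fun u ξ η => by
    refine canonicalBivector_comp ?_ ξ η
    rw [hk, fderiv_translateEquiv]
    exact hh.poisson _
  have hg : ∀ x, (f.trans H) x = chartExtend ψ k (f x) := fun x => rfl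
  have hgfun : ⇑(f.trans H) = fun x => chartExtend ψ k (f x) := rfl
  have hgS : ∀ x, f x ∉ S → (f.trans H) x = f x := fun x hx => hsupp.chartExtend_eq_self hx
  -- The bump preserves its supporting ball, so the displaced point `k (ψ (f x))` is again in `Z`
  -- and the smallness estimates apply to the pair.
  have hP : ∀ i, ∀ x ∈ 𝒜.K i, f x ∈ S → _ := fun i x hx hxS =>
    @hZN (k (ψ (f x)), x) ⟨(hmem x hxS).2.1, (hmem x hxS).2.2.2.1⟩ i ((hmem x hxS).2.2.2.2 i hx)
  have hmaps : ∀ i, MapsTo (f.trans H) (𝒜.K i) (𝒜.cod i).source := by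
    intro i x hx
    by_cases hxS : f x ∈ S
    · rw [hg, chartExtend_of_mem (hmem x hxS).1]
      exact (hP i x hx hxS).1
    · rw [hgS x hxS]
      exact 𝒜.mapsTo_cod i hx
  refine ⟨f.trans H, ⟨hf.trans hHP, ?_, ?_⟩, ?_⟩
  · refine lt_of_le_of_lt ?_ ((ENNReal.ofReal_lt_ofReal_iff hε).2 (half_lt_self hε))
    rw [C1Charts.dist, if_pos hmaps]
    refine iSup_le fun i => iSup₂_le fun x hx => ?_
    by_cases hxS : f x ∈ S
    · obtain ⟨h1, h2, h3, h4, h5⟩ := hP i x hx hxS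
      have hxψ := (hmem x hxS).1
      refine max_le ?_ ?_
      · rw [← ofReal_norm]
        refine ENNReal.ofReal_le_ofReal ?_
        rw [hg, chartExtend_of_mem hxψ]
        exact h4.le
      · rw [← ofReal_norm]
        refine ENNReal.ofReal_le_ofReal ?_
        rw [hgfun]
        refine (norm_fderiv_inCharts_chartExtend_sub_le (𝒜.dom_mem i) (𝒜.cod_mem i) hψ.1 hsupp
          f.contMDiff hkd hkκ h3 hxψ h2 (hmaps i hx)).trans h5.le
    -- Since `S` is closed, `g` and `f` agree near such an `x`, so their derivatives agree as well
    -- as their values.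
    · have hev := eventually_apply_symm_mem f.continuous.continuousAt (𝒜.subset_dom i hx)
        hsupp.isClosed_image.isOpen_compl hxS
      have heq : inCharts (𝒜.dom i) (𝒜.cod i) (f.trans H) =ᶠ[𝓝 (𝒜.dom i x)]
          inCharts (𝒜.dom i) (𝒜.cod i) f := by
        filter_upwards [hev] with u hu
        rw [inCharts, inCharts, hgS _ hu]
      rw [heq.fderiv_eq, hgS x hxS]
      simp
  · intro x hx
    by_cases hxS : f x ∈ S
    · rcases hx with hx | rfl
      · exact absurd (hmem x hxS).2.2.1 hx
      · rw [hg, chartExtend_of_mem hpψ, ← hu₀, hku₀, hu₀, ψ.left_inv hpψ]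
    · exact hgS x hxS
  · have heq := hsupp.inCharts_comp_chartExtend_eventuallyEq f.continuous hpφ hpψ
    have hφp : inCharts φ ψ f (φ p) = u₀ := by rw [inCharts, φ.left_inv hpφ]
    have hd : DifferentiableAt ℝ (inCharts φ ψ f) (φ p) :=
      (contDiffAt_inCharts hφ.1 hψ.1 f.contMDiff (φ.map_source hpφ)
        (by rwa [φ.left_inv hpφ])).differentiableAt (by simp)
    have hfd : fderiv ℝ (inCharts φ ψ (f.trans H)) (φ p) =
        Matrix.toEuclideanCLM (𝕜 := ℝ) (poissonExtension n A) *
          fderiv ℝ (inCharts φ ψ f) (φ p) := by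
      rw [hgfun, heq.fderiv_eq, fderiv_comp _ hkd.differentiableAt hd, hφp, hk,
        fderiv_translateEquiv, sub_self, hhA]
      rfl
    rw [derivMatrix, derivMatrix, hfd, map_mul]
    simp

end Main

end
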